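/- **Setting.** Let $I=\{0=t_0<t_1<\dots<t_N=T\}$ and let $\mathcal K\subset\mathbb R^d$ be compact. $\mathcal{FP}_I(\mathcal K)$ denotes the collection of filtered processes $\mathbb X=(\Omega,\mathcal F,(\mathcal F_t)_{t\in I},\mathbb P,X)$, where $X=(X_t)_{t\in I}$ is an adapted process with values in $\mathcal K$ on a filtered probability space. The prediction process of $\mathbb X$ is the $\mathcal P((\mathbb R^d)^I)$-valued process $\hat X^1_t=\mathbb P[X\in\cdot\mid\mathcal F_t]$, $t\in I$ (regular conditional laws). All spaces $\mathcal P(\cdot)$ of Borel probability measures carry the weak topology. For a real Hilbert space $H$ let $\tilde H=\{(h_n)_{n\ge0}: h_n\in H^{\hat\otimes n},\ \sum_n\|h_n\|^2<\infty\}$ with $\|h\|_{\tilde H}^2=\sum_n\|h_n\|^2$, where $H^{\hat\otimes n}$ is the Hilbert tensor power, and let $\exp_\otimes(h)=\sum_n h^{\otimes n}/n!\in\tilde H$. The time-augmented signature of $x=(x_t)_{t\in I}\in H^I$ is $$S_H(x)=\prod_{i=0}^N\exp_\otimes\big(t_i-t_{i-1},\,x_{t_i}-x_{t_{i-1}}\big)\in\widetilde{\mathbb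 R\oplus H},\qquad t_{-1}:=0,\ x_{t_{-1}}:=0.$$ Put $\mathcal H^1=\widetilde{\mathbb R\oplus\mathbb R^d}$, $S=S_{\mathbb R^d}$, $\mathcal H^2=\widetilde{\mathbb R\oplus\mathcal H^1}$, and $S^2(\mu)=S_{\mathcal H^1}\big(t\mapsto\int S(x)\,\mu_t(dx)\big)\in\mathcal H^2$ for a path $\mu=(\mu_t)_{t\in I}$ of probability measures on $\mathcal K^I$. Expectations of $S$ and $S^2$ are Bochner integrals. Let $\hat\tau_0$ be the topology on $\mathcal{FP}_I(\mathcal K)$ induced by $\mathbb X\mapsto\mathcal L(X)\in\mathcal P((\mathbb R^d)^I)$ (weak convergence of laws), and $\hat\tau_1$ the one induced by $\mathbb X\mapsto\mathcal L(\hat X^1)\in\mathcal P(\mathcal P((\mathbb R^d)^I)^I)$ (Aldous' extended weak convergence). **Theorem.** 1. The rank 1 signature MMD $\mathcal D^1_{\mathcal S}(\mathbb X,\mathbb Y)=\|\mathbb E_{\mathbb P}[S(X)]-\mathbb E_{\mathbb Q}[S(Y)]\|_{\mathcal H^1}$ metrizes $\hat\tau_0$ on $\mathcal{FP}_I(\mathcal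 K)$: it is a pseudometric, the topology it generates is $\hat\tau_0$, it vanishes exactly when $\mathcal L(X)=\mathcal L(Y)$, and $\mathcal L(X^n)\to\mathcal L(X)$ weakly if and only if $\mathcal D^1_{\mathcal S}(\mathbb X^n,\mathbb X)\to0$. 2. The rank 2 signature MMD $\mathcal D^2_{\mathcal S}(\mathbb X,\mathbb Y)=\|\mathbb E_{\mathbb P}[S^2(\hat X^1)]-\mathbb E_{\mathbb Q}[S^2(\hat Y^1)]\|_{\mathcal H^2}$ metrizes $\hat\tau_1$ on $\mathcal{FP}_I(\mathcal K)$: it is a pseudometric, the topology it generates is $\hat\tau_1$, it vanishes exactly when $\mathcal L(\hat X^1)=\mathcal L(\hat Y^1)$, and $\mathcal L(\hat X^{n,1})\to\mathcal L(\hat X^1)$ weakly if and only if $\mathcal D^2_{\mathcal S}(\mathbb X^n,\mathbb X)\to0$. -/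

import Mathlib

open MeasureTheory ProbabilityTheory Filter Topology
open scoped ENNReal NNReal Nat

universe u

namespace SigMMD

noncomputable section

/-! ### Tensor series over an orthonormal basis

For a real Hilbert space with orthonormal basis `(e_i)_{i ∈ ι}`, the completed tensor power of
order `n` has the orthonormal basis `e_{i₁} ⊗ ⋯ ⊗ e_{iₙ}`, indexed by the words `[i₁, …, iₙ]`.
Tensor series are written in these coordinates, as functions on words. -/

/-- Coefficients of a tensor series with respect to the basis `e_{i₁} ⊗ ⋯ ⊗ e_{iₙ}`. -/
abbrev TensorSeries (ι : Type*) : Type _ := List ι → ℝ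

/-- The Hilbert space `ℓ²(ι)` with orthonormal basis indexed by `ι`. -/
abbrev L2 (ι : Type*) : Type _ := lp (fun _ : ι => ℝ) 2

/-- The Hilbert space `H̃` of square summable tensor series over `H = ℓ²(ι)`: the Hilbert sum over
`n` of the completed tensor powers of order `n` of `H`. -/
abbrev TensorL2 (ι : Type*) : Type _ := L2 (List ι)

/-- The tensor product of two tensor series:
`(a ⊗ b)_n = ∑_{k ≤ n} a_k ⊗ b_{n-k}` in coordinates. -/
def tmul {ι : Type*} (a b : TensorSeries ι) : TensorSeries ι := fun w =>
  ∑ k ∈ Finset.range (w.length + 1), a (w.take k) * b (w.drop k)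

/-- The unit `1` of the tensor product. -/
def tone {ι : Type*} : TensorSeries ι
  | [] => 1
  | _ :: _ => 0

/-- The tensor exponential `∑_n h^{⊗ n} / n!`; the coordinate of `h^{⊗ n}` at `[i₁, …, iₙ]` is
`h_{i₁} ⋯ h_{iₙ}`. -/
def texp {ι : Type*} (h : ι → ℝ) : TensorSeries ι := fun w => (w.map h).prod / (w.length ! : ℝ)

/-- The vector `(s, h) ∈ ℝ ⊕ H`, with the coordinate `none` for the time direction. -/
def augment {ι : Type*} (s : ℝ) (h : ι → ℝ) : Option ι → ℝ
  | none => s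
  | some i => h i

/-- The increment `z_i - z_{i-1}` of a discrete path, with the convention `z_{-1} = 0`. -/
def increment {E : Type*} [AddGroup E] {N : ℕ} (z : Fin (N + 1) → E) (i : Fin (N + 1)) : E :=
  Fin.cases (z 0) (fun j : Fin N => z j.succ - z j.castSucc) i

/-- The series `∏_{i=0}^N exp (t_i - t_{i-1}, x_i - x_{i-1})`, factors in increasing order of
`i`. -/
def sigSeries {ι : Type*} {N : ℕ} (t : Fin (N + 1) → ℝ) (x : Fin (N + 1) → L2 ι) :
    TensorSeries (Option ι) :=
  (List.ofFn fun i : Fin (N + 1) =>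
    texp (augment (increment t i) (increment x i : L2 ι))).foldr tmul tone

/-! Square summability of `sigSeries`. -/

/-- The tensors of order `n` of a series have squared norm at most `M ^ n / n !`. -/
def LevelBound {ι : Type*} (a : TensorSeries ι) (M : ℝ) : Prop :=
  ∀ (n : ℕ) (s : Finset (List ι)), (∀ w ∈ s, w.length = n) → ∑ w ∈ s, a w ^ 2 ≤ M ^ n / (n ! : ℝ)

lemma sum_take_drop_le {ι : Type*} (f g : List ι → ℝ) (hf : ∀ w, 0 ≤ f w) (hg : ∀ w, 0 ≤ g w)
    (n k : ℕ) (hk : k ≤ n) (A B : ℝ) (hA : 0 ≤ A)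
    (hfA : ∀ s : Finset (List ι), (∀ w ∈ s, w.length = k) → ∑ w ∈ s, f w ≤ A)
    (hgB : ∀ s : Finset (List ι), (∀ w ∈ s, w.length = n - k) → ∑ w ∈ s, g w ≤ B)
    (s : Finset (List ι)) (hs : ∀ w ∈ s, w.length = n) :
    ∑ w ∈ s, f (w.take k) * g (w.drop k) ≤ A * B := by
  classical
  let ψ : List ι → List ι × List ι := fun w => (w.take k, w.drop k)
  have hinj : Set.InjOn ψ s := by
    intro w _ w' _ h
    have h1 : w.take k = w'.take k := congrArg Prod.fst h
    have h2 : w.drop k = w'.drop k := congrArg Prod.snd h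
    rw [← List.take_append_drop k w, ← List.take_append_drop k w', h1, h2]
  calc ∑ w ∈ s, f (w.take k) * g (w.drop k)
      = ∑ p ∈ s.image ψ, f p.1 * g p.2 := by rw [Finset.sum_image hinj]
    _ ≤ ∑ p ∈ (s.image (List.take k)) ×ˢ (s.image (List.drop k)), f p.1 * g p.2 := by
        refine Finset.sum_le_sum_of_subset_of_nonneg ?_ fun p _ _ => mul_nonneg (hf _) (hg _)
        intro p hp
        obtain ⟨w, hw, rfl⟩ := Finset.mem_image.1 hp
        exact Finset.mem_product.2
          ⟨Finset.mem_image_of_mem _ hw, Finset.mem_image_of_mem _ hw⟩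
    _ = (∑ p ∈ s.image (List.take k), f p) * ∑ q ∈ s.image (List.drop k), g q := by
        rw [Finset.sum_mul_sum, Finset.sum_product]
    _ ≤ A * B := by
        refine mul_le_mul (hfA _ ?_) (hgB _ ?_) (Finset.sum_nonneg fun _ _ => hg _) hA
        · intro v hv
          obtain ⟨w, hw, rfl⟩ := Finset.mem_image.1 hv
          simp [hs w hw, hk]
        · intro v hv
          obtain ⟨w, hw, rfl⟩ := Finset.mem_image.1 hv
          simp [hs w hw]

lemma LevelBound.tmul {ι : Type*} {a b : TensorSeries ι} {M L : ℝ} (hM : 0 ≤ M) (hL : 0 ≤ L)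
    (ha : LevelBound a M) (hb : LevelBound b L) : LevelBound (tmul a b) (2 * (M + L)) := by
  intro n s hs
  have hpt : ∀ w ∈ s, (SigMMD.tmul a b w) ^ 2 ≤
      (n + 1 : ℝ) * ∑ k ∈ Finset.range (n + 1), a (w.take k) ^ 2 * b (w.drop k) ^ 2 := by
    intro w hw
    have h := sq_sum_le_card_mul_sum_sq (s := Finset.range (n + 1))
      (f := fun k => a (w.take k) * b (w.drop k))
    simp only [Finset.card_range, Nat.cast_add, Nat.cast_one, mul_pow] at h
    simpa [SigMMD.tmul, hs w hw] using h
  have h2 : ((n : ℝ) + 1) ≤ 2 ^ n := by exact_mod_cast Nat.lt_two_pow_self (n := n)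
  have hbin : ∑ k ∈ Finset.range (n + 1), (M ^ k / (k ! : ℝ)) * (L ^ (n - k) / ((n - k) ! : ℝ))
      = (M + L) ^ n / (n ! : ℝ) := by
    rw [add_pow, Finset.sum_div]
    refine Finset.sum_congr rfl fun k hk => ?_
    have hk' : k ≤ n := Nat.lt_succ_iff.1 (Finset.mem_range.1 hk)
    rw [Nat.cast_choose ℝ hk']
    have := Nat.factorial_ne_zero n
    have := Nat.factorial_ne_zero k
    have := Nat.factorial_ne_zero (n - k)
    field_simp
  calc ∑ w ∈ s, (SigMMD.tmul a b w) ^ 2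
      ≤ ∑ w ∈ s, (n + 1 : ℝ) *
          ∑ k ∈ Finset.range (n + 1), a (w.take k) ^ 2 * b (w.drop k) ^ 2 :=
        Finset.sum_le_sum hpt
    _ = (n + 1 : ℝ) * ∑ k ∈ Finset.range (n + 1), ∑ w ∈ s,
          a (w.take k) ^ 2 * b (w.drop k) ^ 2 := by
        rw [← Finset.mul_sum, Finset.sum_comm]
    _ ≤ (n + 1 : ℝ) * ∑ k ∈ Finset.range (n + 1),
          (M ^ k / (k ! : ℝ)) * (L ^ (n - k) / ((n - k) ! : ℝ)) := by
        refine mul_le_mul_of_nonneg_left (Finset.sum_le_sum fun k hk => ?_) (by positivity)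
        exact sum_take_drop_le (fun w => a w ^ 2) (fun w => b w ^ 2) (fun _ => sq_nonneg _)
          (fun _ => sq_nonneg _) n k (Nat.lt_succ_iff.1 (Finset.mem_range.1 hk)) _ _
          (by positivity) (ha k) (hb (n - k)) s hs
    _ = (n + 1 : ℝ) * ((M + L) ^ n / (n ! : ℝ)) := by rw [hbin]
    _ ≤ 2 ^ n * ((M + L) ^ n / (n ! : ℝ)) :=
        mul_le_mul_of_nonneg_right h2 (by positivity)
    _ = (2 * (M + L)) ^ n / (n ! : ℝ) := by rw [mul_pow]; ring

lemma levelBound_tone {ι : Type*} : LevelBound (tone : TensorSeries ι) 0 := by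
  intro n s hs
  cases n with
  | zero =>
    have : s ⊆ {[]} := fun w hw => by simpa using hs w hw
    refine (Finset.sum_le_sum_of_subset_of_nonneg this fun _ _ _ => sq_nonneg _).trans ?_
    simp [tone]
  | succ n =>
    refine le_of_eq ?_
    rw [zero_pow n.succ_ne_zero, zero_div]
    refine Finset.sum_eq_zero fun w hw => ?_
    cases w with
    | nil => simpa using hs _ hw
    | cons i w => simp [tone]

lemma levelBound_texp {ι : Type*} {h : ι → ℝ} (hh : Summable fun i => h i ^ 2) :
    LevelBound (texp h) (∑' i, h i ^ 2) := by
  classical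
  have hH : 0 ≤ ∑' i, h i ^ 2 := tsum_nonneg fun _ => sq_nonneg _
  have key : ∀ (n : ℕ) (s : Finset (List ι)), (∀ w ∈ s, w.length = n) →
      ∑ w ∈ s, (w.map h).prod ^ 2 ≤ (∑' i, h i ^ 2) ^ n := by
    intro n
    induction n with
    | zero =>
      intro s hs
      have : s ⊆ {[]} := fun w hw => by simpa using hs w hw
      refine (Finset.sum_le_sum_of_subset_of_nonneg this fun _ _ _ => sq_nonneg _).trans ?_
      simp
    | succ n ih =>
      intro s hs
      have h1 : ∀ s : Finset (List ι), (∀ w ∈ s, w.length = 1) →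
          ∑ w ∈ s, (w.map h).prod ^ 2 ≤ ∑' i, h i ^ 2 := by
        intro s hs
        have hsub : s ⊆ (s.biUnion List.toFinset).image (fun i => [i]) := by
          intro w hw
          obtain ⟨i, rfl⟩ := List.length_eq_one_iff.1 (hs w hw)
          exact Finset.mem_image.2 ⟨i, Finset.mem_biUnion.2 ⟨[i], hw, by simp⟩, rfl⟩
        refine (Finset.sum_le_sum_of_subset_of_nonneg hsub fun _ _ _ => sq_nonneg _).trans ?_
        rw [Finset.sum_image (fun i _ j _ hij => by simpa using hij)]
        simpa using hh.sum_le_tsum _ fun _ _ => sq_nonneg _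
      have := sum_take_drop_le (fun w => (w.map h).prod ^ 2) (fun w => (w.map h).prod ^ 2)
        (fun _ => sq_nonneg _) (fun _ => sq_nonneg _) (n + 1) 1 (by omega) _ _ hH h1
        (by simpa using ih) s hs
      rw [pow_succ']
      refine le_trans (le_of_eq (Finset.sum_congr rfl fun w _ => ?_)) this
      rw [← mul_pow, ← List.prod_append, ← List.map_append, List.take_append_drop]
  intro n s hs
  have hn : (1 : ℝ) ≤ (n ! : ℝ) := by exact_mod_cast Nat.factorial_pos n
  calc ∑ w ∈ s, texp h w ^ 2 = (∑ w ∈ s, (w.map h).prod ^ 2) / (n ! : ℝ) ^ 2 := by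
        rw [Finset.sum_div]
        exact Finset.sum_congr rfl fun w hw => by rw [texp, hs w hw, div_pow]
    _ ≤ (∑' i, h i ^ 2) ^ n / (n ! : ℝ) ^ 2 :=
        div_le_div_of_nonneg_right (key n s hs) (by positivity)
    _ ≤ (∑' i, h i ^ 2) ^ n / (n ! : ℝ) :=
        div_le_div_of_nonneg_left (by positivity) (by positivity) (le_self_pow₀ hn two_ne_zero)

lemma LevelBound.memℓp {ι : Type*} {a : TensorSeries ι} {M : ℝ} (hM : 0 ≤ M)
    (ha : LevelBound a M) : Memℓp a 2 := by
  classical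
  refine memℓp_gen ?_
  simp only [ENNReal.toReal_ofNat, Real.rpow_ofNat, Real.norm_eq_abs, sq_abs]
  refine summable_of_sum_le (c := Real.exp M) (fun _ => sq_nonneg _) fun s => ?_
  calc ∑ w ∈ s, a w ^ 2
      = ∑ n ∈ s.image List.length, ∑ w ∈ s with w.length = n, a w ^ 2 :=
        (Finset.sum_fiberwise_of_maps_to (fun w hw => Finset.mem_image_of_mem _ hw) _).symm
    _ ≤ ∑ n ∈ s.image List.length, M ^ n / (n ! : ℝ) :=
        Finset.sum_le_sum fun n _ => ha n _ fun w hw => (Finset.mem_filter.1 hw).2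
    _ ≤ ∑' n : ℕ, M ^ n / (n ! : ℝ) :=
        (Real.summable_pow_div_factorial M).sum_le_tsum _ fun _ _ => by positivity
    _ = Real.exp M := by
        rw [Real.exp_eq_exp_ℝ, NormedSpace.exp_eq_tsum_div]

lemma summable_augment {ι : Type*} (s : ℝ) (h : L2 ι) :
    Summable fun i => augment s h i ^ 2 := by
  have hs : Summable fun i => (h i) ^ 2 := by
    have := (lp.memℓp h).summable (by simp)
    simpa using this
  classical
  refine summable_of_sum_le (c := s ^ 2 + ∑' i, h i ^ 2) (fun _ => sq_nonneg _) fun v => ?_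
  refine (Finset.sum_le_sum_of_subset_of_nonneg (t := Finset.insertNone (Finset.eraseNone v))
    ?_ fun _ _ _ => sq_nonneg _).trans ?_
  · rw [Finset.insertNone_eraseNone]
    exact Finset.subset_insert _ _
  · rw [Finset.sum_insertNone]
    simpa [augment] using hs.sum_le_tsum _ fun _ _ => sq_nonneg _

lemma memℓp_sigSeries {ι : Type*} {N : ℕ} (t : Fin (N + 1) → ℝ) (x : Fin (N + 1) → L2 ι) :
    Memℓp (sigSeries t x) 2 := by
  have : ∀ l : List (TensorSeries (Option ι)), (∀ a ∈ l, ∃ M, 0 ≤ M ∧ LevelBound a M) →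
      ∃ M, 0 ≤ M ∧ LevelBound (l.foldr tmul tone) M := by
    intro l
    induction l with
    | nil => exact fun _ => ⟨0, le_rfl, levelBound_tone⟩
    | cons a l ih =>
      intro hl
      obtain ⟨M, hM, hb⟩ := hl a (by simp)
      obtain ⟨L, hL, hc⟩ := ih fun b hb => hl b (by simp [hb])
      exact ⟨2 * (M + L), by positivity, hb.tmul hM hL hc⟩
  obtain ⟨M, hM, hb⟩ := this (List.ofFn fun i : Fin (N + 1) =>
      texp (augment (increment t i) (increment x i : L2 ι))) (by
    intro a ha
    obtain ⟨i, rfl⟩ := (List.mem_ofFn' _ _).1 ha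
    exact ⟨_, tsum_nonneg fun _ => sq_nonneg _, levelBound_texp (summable_augment _ _)⟩)
  exact hb.memℓp hM

/-! ### Signatures of rank one and two -/

/-- The time-augmented signature `S_H` of a discrete path in `H = ℓ²(ι)` observed at the times
`t_0 < ⋯ < t_N`, an element of the Hilbert space of square summable tensor series over `ℝ ⊕ H`. -/
def signature {ι : Type*} {N : ℕ} (t : Fin (N + 1) → ℝ) (x : Fin (N + 1) → L2 ι) :
    TensorL2 (Option ι) :=
  ⟨sigSeries t x, memℓp_sigSeries t x⟩

/-- `ℝ^d`. -/
abbrev State (d : ℕ) : Type := EuclideanSpace ℝ (Fin d)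

/-- The path space `(ℝ^d)^I` for `I = {t_0 < ⋯ < t_N}`. -/
abbrev PathSpace (N d : ℕ) : Type := Fin (N + 1) → State d

/-- The space `𝓗¹` of square summable tensor series over `ℝ ⊕ ℝ^d`. -/
abbrev H1 (d : ℕ) : Type := TensorL2 (Option (Fin d))

/-- The space `𝓗²` of square summable tensor series over `ℝ ⊕ 𝓗¹`. -/
abbrev H2 (d : ℕ) : Type := TensorL2 (Option (List (Option (Fin d))))

/-- `ℝ^d` as the space `ℓ²` over its coordinates. -/
def toL2 {d : ℕ} (x : State d) : L2 (Fin d) := ⟨fun i => x i, Memℓp.all _⟩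

/-- The time-augmented signature `S : (ℝ^d)^I → 𝓗¹`. -/
def S1 {N d : ℕ} (t : Fin (N + 1) → ℝ) (x : PathSpace N d) : H1 d :=
  signature t fun i => toL2 (x i)

/-- The rank two signature `S²` of a path of probability measures on path space: the signature of
the `𝓗¹`-valued path of expected signatures. -/
def S2 {N d : ℕ} (t : Fin (N + 1) → ℝ) (μ : Fin (N + 1) → ProbabilityMeasure (PathSpace N d)) : H2 d :=
  signature t fun i => ∫ x, S1 t x ∂(μ i : Measure (PathSpace N d))

/-! ### Filtered processes and prediction processes -/

/-- A filtered process indexed by `I = {t_0 < ⋯ < t_N}` with values in `K ⊆ ℝ^d`. -/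
structure FilteredProcess (N d : ℕ) (K : Set (State d)) : Type (u + 1) where
  Ω : Type u
  mΩ : MeasurableSpace Ω
  filtration : Filtration (Fin (N + 1)) mΩ
  P : Measure Ω
  isProbabilityMeasure : IsProbabilityMeasure P
  X : Fin (N + 1) → Ω → State d
  adapted : Adapted filtration X
  mem : ∀ i ω, X i ω ∈ K

attribute [instance] FilteredProcess.mΩ FilteredProcess.isProbabilityMeasure

/-- Integrals of the continuous approximations of the complements of finite unions of basic open
sets. -/
def testIntegrals (E : Type*) [TopologicalSpace E] [TopologicalSpace.PseudoMetrizableSpace E]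
    [SecondCountableTopology E] [MeasurableSpace E] [OpensMeasurableSpace E]
    (μ : ProbabilityMeasure E) (p : Finset (TopologicalSpace.countableBasis E) × ℕ) : ℝ≥0∞ :=
  ∫⁻ x, ((isOpen_biUnion (s := (p.1 : Set (TopologicalSpace.countableBasis E)))
    (f := fun U => (U : Set E)) fun U _ =>
      TopologicalSpace.isOpen_of_mem_countableBasis U.2).isClosed_compl.apprSeq p.2 x : ℝ≥0∞)
      ∂(μ : Measure E)

lemma isInducing_testIntegrals (E : Type*) [TopologicalSpace E]
    [TopologicalSpace.PseudoMetrizableSpace E]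
    [SecondCountableTopology E] [MeasurableSpace E] [OpensMeasurableSpace E] :
    IsInducing (testIntegrals E) := by
  classical
  refine isInducing_iff_nhds.2 fun μ => le_antisymm ?_ ?_
  · refine tendsto_iff_comap.1 (tendsto_pi_nhds.2 fun p => ?_)
    exact (ProbabilityMeasure.tendsto_iff_forall_lintegral_tendsto.1 tendsto_id) _
  · have : Tendsto id (comap (testIntegrals E) (𝓝 (testIntegrals E μ))) (𝓝 μ) := by
      refine tendsto_of_forall_isOpen_le_liminf' fun G hG => ?_
      refine le_of_forall_lt fun r hr => ?_
      lift r to ℝ≥0 using hr.ne_top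
      obtain ⟨r', hr1, hr2⟩ := ENNReal.lt_iff_exists_nnreal_btwn.1 hr
      have hr2' : r' < μ G := by
        rw [← ENNReal.coe_lt_coe]; simpa using hr2
      obtain ⟨T, hT, hrT, hTG⟩ := μ.exists_lt_measure_biUnion_of_isOpen
        (S := TopologicalSpace.countableBasis E) (fun u hu x hx => by
          obtain ⟨v, hv, hxv, hvu⟩ :=
            (TopologicalSpace.isBasis_countableBasis E).exists_subset_of_mem_open hx hu
          exact ⟨v, hv, (TopologicalSpace.isOpen_of_mem_countableBasis hv).mem_nhds hxv, hvu⟩)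
        hG hr2'
      let T' : Finset (TopologicalSpace.countableBasis E) := T.subtype _
      let V : Set E := ⋃ U ∈ (T' : Set (TopologicalSpace.countableBasis E)), (U : Set E)
      have hVT : V = ⋃ t ∈ T, t := by
        ext x
        simp only [V, T', Set.mem_iUnion, Finset.mem_coe, Finset.mem_subtype]
        constructor
        · rintro ⟨U, hU, hx⟩
          exact ⟨U, hU, hx⟩
        · rintro ⟨U, hU, hx⟩
          exact ⟨⟨U, hT U hU⟩, hU, hx⟩
      have hVo : IsOpen V := isOpen_biUnion fun U _ =>
        TopologicalSpace.isOpen_of_mem_countableBasis U.2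
      have hrV : (r' : ℝ≥0∞) < (μ : Measure E) V := by
        rw [hVT, ← ProbabilityMeasure.ennreal_coeFn_eq_coeFn_toMeasure]
        exact_mod_cast hrT
      have hcompl : ∀ ν : ProbabilityMeasure E, (ν : Measure E) Vᶜ = 1 - (ν : Measure E) V :=
        fun ν => prob_compl_eq_one_sub hVo.measurableSet
      have hr'1 : (r' : ℝ≥0∞) < 1 := hrV.trans_le prob_le_one
      have hlt : (μ : Measure E) Vᶜ < 1 - r' := by
        rw [hcompl]
        refine not_le.1 fun h => ?_
        exact not_le.2 hrV ((ENNReal.sub_le_sub_iff_left prob_le_one ENNReal.one_ne_top).1 h)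
      obtain ⟨n, hn⟩ := ((HasOuterApproxClosed.tendsto_lintegral_apprSeq hVo.isClosed_compl
        (μ : Measure E)).eventually_lt_const hlt).exists
      have hev : ∀ᶠ ν in comap (testIntegrals E) (𝓝 (testIntegrals E μ)),
          testIntegrals E ν (T', n) < 1 - r' :=
        (((continuous_apply (T', n)).tendsto (testIntegrals E μ)).comp
          tendsto_comap).eventually_lt_const hn
      refine lt_of_lt_of_le hr1 (le_liminf_of_le (by isBoundedDefault) ?_)
      filter_upwards [hev] with ν hν
      have h1 : (ν : Measure E) Vᶜ < 1 - r' :=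
        (HasOuterApproxClosed.measure_le_lintegral hVo.isClosed_compl _ n).trans_lt hν
      rw [hcompl] at h1
      have h2 : (r' : ℝ≥0∞) < (ν : Measure E) V := by
        by_contra hle
        exact absurd h1 (not_lt.2 (tsub_le_tsub_left (not_lt.1 hle) _))
      exact h2.le.trans (measure_mono (hVT ▸ hTG))
    exact tendsto_id'.1 this

lemma measurable_testIntegrals (E : Type*) [TopologicalSpace E]
    [TopologicalSpace.PseudoMetrizableSpace E]
    [SecondCountableTopology E] [MeasurableSpace E] [OpensMeasurableSpace E] :
    Measurable (testIntegrals E) := by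
  refine measurable_pi_iff.2 fun p => ?_
  exact (Measure.measurable_lintegral
    (BoundedContinuousFunction.continuous _).measurable.coe_nnreal_ennreal).comp
      measurable_subtype_coe

instance instSecondCountableProbabilityMeasure (E : Type*) [TopologicalSpace E]
    [TopologicalSpace.PseudoMetrizableSpace E]
    [SecondCountableTopology E] [MeasurableSpace E] [OpensMeasurableSpace E] :
    SecondCountableTopology (ProbabilityMeasure E) :=
  (isInducing_testIntegrals E).secondCountableTopology

/-- Weakly open sets of probability measures are measurable, so that a law on the space of
probability measures is a Borel law for the weak topology. -/
instance instOpensMeasurableProbabilityMeasure (E : Type*) [TopologicalSpace E]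
    [TopologicalSpace.PseudoMetrizableSpace E]
    [SecondCountableTopology E] [MeasurableSpace E] [OpensMeasurableSpace E] :
    OpensMeasurableSpace (ProbabilityMeasure E) where
  borel_le := by
    refine MeasurableSpace.generateFrom_le fun s hs => ?_
    obtain ⟨o, ho, rfl⟩ := (isInducing_testIntegrals E).isOpen_iff.1 hs
    exact measurable_testIntegrals E ho.measurableSet

namespace FilteredProcess

variable {N d : ℕ} {K : Set (State d)}

/-- The trajectory of the process, as a random element of path space. -/
def path (𝕏 : FilteredProcess.{u} N d K) (ω : 𝕏.Ω) : PathSpace N d := fun i => 𝕏.X i ω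

lemma measurable_path (𝕏 : FilteredProcess.{u} N d K) : Measurable 𝕏.path :=
  measurable_pi_iff.2 fun i => (𝕏.adapted i).mono (𝕏.filtration.le i) le_rfl

/-- The prediction process `X̂_i = P[X ∈ · | 𝓕_i]`, as a regular conditional distribution of the
trajectory given the `σ`-algebra `𝓕_i`. -/
def prediction (𝕏 : FilteredProcess.{u} N d K) (ω : 𝕏.Ω) (i : Fin (N + 1)) :
    ProbabilityMeasure (PathSpace N d) :=
  letI κ := @condDistrib 𝕏.Ω 𝕏.Ω (PathSpace N d) _ _ _ 𝕏.mΩ (𝕏.filtration i) 𝕏.path id 𝕏.P _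
  ⟨κ ω, by infer_instance⟩

/-- `X̂_i` is adapted. -/
lemma measurable_prediction_filtration (𝕏 : FilteredProcess.{u} N d K) (i : Fin (N + 1)) :
    Measurable[𝕏.filtration i] fun ω => 𝕏.prediction ω i :=
  Measurable.subtype_mk
    (@condDistrib 𝕏.Ω 𝕏.Ω (PathSpace N d) _ _ _ 𝕏.mΩ (𝕏.filtration i) 𝕏.path id 𝕏.P _).measurable

/-- `X̂_i` is a version of the conditional law of the trajectory given `𝓕_i`. -/
lemma prediction_ae_eq (𝕏 : FilteredProcess.{u} N d K) (i : Fin (N + 1)) {A : Set (PathSpace N d)}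
    (hA : MeasurableSet A) :
    (fun ω => (𝕏.prediction ω i : Measure (PathSpace N d)).real A) =ᵐ[𝕏.P]
      𝕏.P[(𝕏.path ⁻¹' A).indicator (fun _ => (1 : ℝ)) | 𝕏.filtration i] := by
  have h := @condDistrib_ae_eq_condExp 𝕏.Ω 𝕏.Ω (PathSpace N d) _ _ _ 𝕏.mΩ 𝕏.P _ id 𝕏.path
    (𝕏.filtration i) A (measurable_id'' (𝕏.filtration.le i)) 𝕏.measurable_path hA
  rw [MeasurableSpace.comap_id] at h
  exact h

lemma measurable_prediction (𝕏 : FilteredProcess.{u} N d K) : Measurable 𝕏.prediction :=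
  measurable_pi_iff.2 fun i =>
    (𝕏.measurable_prediction_filtration i).mono (𝕏.filtration.le i) le_rfl

/-- The law of the trajectory `X`. -/
def law0 (𝕏 : FilteredProcess.{u} N d K) : ProbabilityMeasure (PathSpace N d) :=
  ⟨𝕏.P.map 𝕏.path, Measure.isProbabilityMeasure_map 𝕏.measurable_path.aemeasurable⟩

/-- The law of the prediction process `X̂`. -/
def law1 (𝕏 : FilteredProcess.{u} N d K) :
    ProbabilityMeasure (Fin (N + 1) → ProbabilityMeasure (PathSpace N d)) :=
  ⟨𝕏.P.map 𝕏.prediction, Measure.isProbabilityMeasure_map 𝕏.measurable_prediction.aemeasurable⟩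

end FilteredProcess

/-! ### Adapted topologies and signature discrepancies -/

/-- The topology of weak convergence of the laws of the processes. -/
abbrev tau0 (N d : ℕ) (K : Set (State d)) : TopologicalSpace (FilteredProcess.{u} N d K) :=
  TopologicalSpace.induced FilteredProcess.law0 inferInstance

/-- The topology of extended weak convergence, i.e. of weak convergence of the laws of the
prediction processes. -/
abbrev tau1 (N d : ℕ) (K : Set (State d)) : TopologicalSpace (FilteredProcess.{u} N d K) :=
  TopologicalSpace.induced FilteredProcess.law1 inferInstance

/-- The rank one signature discrepancy `‖E[S(X)] - E[S(Y)]‖`. -/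
def D1 {N d : ℕ} {K : Set (State d)} (t : Fin (N + 1) → ℝ) (𝕏 𝕐 : FilteredProcess.{u} N d K) :
    ℝ :=
  ‖(∫ ω, S1 t (𝕏.path ω) ∂𝕏.P) - ∫ ω, S1 t (𝕐.path ω) ∂𝕐.P‖

/-- The rank two signature discrepancy `‖E[S²(X̂)] - E[S²(Ŷ)]‖`. -/
def D2 {N d : ℕ} {K : Set (State d)} (t : Fin (N + 1) → ℝ) (𝕏 𝕐 : FilteredProcess.{u} N d K) :
    ℝ :=
  ‖(∫ ω, S2 t (𝕏.prediction ω) ∂𝕏.P) - ∫ ω, S2 t (𝕐.prediction ω) ∂𝕐.P‖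

/-- `D` is a pseudometric whose balls generate the topology `τ`. -/
structure Metrizes {α : Type*} (D : α → α → ℝ) (τ : TopologicalSpace α) : Prop where
  self : ∀ x, D x x = 0
  symm : ∀ x y, D x y = D y x
  triangle : ∀ x y z, D x z ≤ D x y + D y z
  isOpen_iff : ∀ s : Set α, IsOpen[τ] s ↔ ∀ x ∈ s, ∃ ε > 0, ∀ y, D x y < ε → y ∈ s

end

end SigMMD

open SigMMD

/-!
A product of tensor exponentials is group-like: its coordinates multiply by shuffles of words, so
the coordinates of the signature, including the constant `1`, span an algebra of functions. The
coordinates at the words `j 0ⁿ`, with `0` the time direction, are the moments of the increments of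
the `j`-th component against the time still to go; as time is strictly increasing, they determine
the path. By Stone–Weierstrass, the expected signature determines the law of a path with values in
a compact set, and since the laws on a compact space form a compact space, taking expected
signatures is a topological embedding. Its values are dominated, coordinate by coordinate, by a
fixed square summable sequence, which is all that was used of the values of a path; so the same
argument applies to paths of laws and gives rank two. Finally, a process with values in a bounded
set and its predictions are carried by the paths in the compact closure of that set.
-/

namespace SigMMD

noncomputable section

/-! ### Group-like series -/

section Shuffle

variable {ι : Type*}

/-- The sum of `f p q` over all splittings `w = p ++ q` of a word: the pairing of `f` with the
deconcatenation coproduct of `w`. -/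
def splitSum (f : List ι → List ι → ℝ) (w : List ι) : ℝ :=
  ∑ k ∈ Finset.range (w.length + 1), f (w.take k) (w.drop k)

lemma splitSum_nil (f : List ι → List ι → ℝ) : splitSum f [] = f [] [] := by
  simp [splitSum]

lemma splitSum_cons (f : List ι → List ι → ℝ) (i : ι) (w : List ι) :
    splitSum f (i :: w) = f [] (i :: w) + splitSum (fun p q => f (i :: p) q) w := by
  rw [splitSum, List.length_cons, Finset.sum_range_succ' _ (w.length + 1), add_comm]
  rfl

lemma splitSum_add (f g : List ι → List ι → ℝ) (w : List ι) :
    splitSum (fun p q => f p q + g p q) w = splitSum f w + splitSum g w :=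
  Finset.sum_add_distrib

lemma splitSum_replicate (f : List ι → List ι → ℝ) (i : ι) (n : ℕ) :
    splitSum f (List.replicate n i) =
      ∑ k ∈ Finset.range (n + 1), f (List.replicate k i) (List.replicate (n - k) i) := by
  rw [splitSum, List.length_replicate]
  refine Finset.sum_congr rfl fun k hk => ?_
  rw [List.take_replicate, List.drop_replicate,
    min_eq_left (Nat.lt_succ_iff.1 (Finset.mem_range.1 hk))]

lemma tmul_eq_splitSum (a b : TensorSeries ι) (w : List ι) :
    tmul a b w = splitSum (fun p q => a p * b q) w := rfl

lemma tmul_cons (a b : TensorSeries ι) (i : ι) (w : List ι) :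
    tmul a b (i :: w) = a [] * b (i :: w) + tmul (fun v => a (i :: v)) b w :=
  splitSum_cons (fun p q => a p * b q) i w

/-- The shuffles of two words, listed with multiplicity. -/
def shuffles : List ι → List ι → List (List ι)
  | [], v => [v]
  | i :: u, [] => [i :: u]
  | i :: u, j :: v => (shuffles u (j :: v)).map (i :: ·) ++ (shuffles (i :: u) v).map (j :: ·)
termination_by u v => u.length + v.length

lemma shuffles_nil_left (v : List ι) : shuffles [] v = [v] := by
  rw [shuffles]

lemma shuffles_nil_right (u : List ι) : shuffles u [] = [u] := by
  cases u <;> rw [shuffles]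

lemma shuffles_cons_cons (i j : ι) (u v : List ι) :
    shuffles (i :: u) (j :: v) =
      (shuffles u (j :: v)).map (i :: ·) ++ (shuffles (i :: u) v).map (j :: ·) := by
  rw [shuffles]

lemma shuffle_induction {p : List ι → List ι → Prop} (left : ∀ v, p [] v) (right : ∀ u, p u [])
    (step : ∀ i u j v, p u (j :: v) → p (i :: u) v → p (i :: u) (j :: v)) (u v : List ι) :
    p u v := by
  induction u generalizing v with
  | nil => exact left v
  | cons i u ihu =>
    induction v with
    | nil => exact right _
    | cons j v ihv => exact step i u j v (ihu _) ihv

lemma length_shuffles (u v : List ι) :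
    (shuffles u v).length = (u.length + v.length).choose u.length := by
  induction u, v using shuffle_induction with
  | left v => simp [shuffles_nil_left]
  | right u => simp [shuffles_nil_right]
  | step i u j v hu hv =>
    simp only [shuffles_cons_cons, List.length_append, List.length_map, hu, hv, List.length_cons]
    rw [← add_assoc, Nat.add_right_comm u.length v.length, ← Nat.choose_succ_succ, ← add_assoc]

lemma perm_of_mem_shuffles {u v w : List ι} (hw : w ∈ shuffles u v) : w.Perm (u ++ v) := by
  induction u, v using shuffle_induction generalizing w with
  | left v => simp_all [shuffles_nil_left]
  | right u => simp_all [shuffles_nil_right]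
  | step i u j v hu hv =>
    rw [shuffles_cons_cons, List.mem_append, List.mem_map, List.mem_map] at hw
    obtain ⟨w, hw, rfl⟩ | ⟨w, hw, rfl⟩ := hw
    · exact (hu hw).cons i
    · exact ((hv hw).cons j).trans List.perm_middle.symm

/-- The coordinate of a series at the shuffle product of two words. -/
def shuffleSum (a : TensorSeries ι) (u v : List ι) : ℝ := ((shuffles u v).map a).sum

lemma shuffleSum_nil_left (a : TensorSeries ι) (v : List ι) : shuffleSum a [] v = a v := by
  simp [shuffleSum, shuffles_nil_left]

lemma shuffleSum_nil_right (a : TensorSeries ι) (u : List ι) : shuffleSum a u [] = a u := by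
  simp [shuffleSum, shuffles_nil_right]

lemma shuffleSum_cons_cons (a : TensorSeries ι) (i j : ι) (u v : List ι) :
    shuffleSum a (i :: u) (j :: v) =
      shuffleSum (fun w => a (i :: w)) u (j :: v) +
        shuffleSum (fun w => a (j :: w)) (i :: u) v := by
  simp only [shuffleSum, shuffles_cons_cons, List.map_append, List.sum_append, List.map_map,
    Function.comp_def]

lemma shuffleSum_add (a b : TensorSeries ι) (u v : List ι) :
    shuffleSum (fun w => a w + b w) u v = shuffleSum a u v + shuffleSum b u v :=
  List.sum_map_add

lemma shuffleSum_mul_left (c : ℝ) (a : TensorSeries ι) (u v : List ι) :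
    shuffleSum (fun w => c * a w) u v = c * shuffleSum a u v :=
  List.sum_map_mul_left _ _ _

/-- Deconcatenation is multiplicative for the shuffle product. -/
lemma shuffleSum_tmul (a b : TensorSeries ι) (u v : List ι) :
    shuffleSum (tmul a b) u v = splitSum (fun p q => splitSum (fun r s =>
      shuffleSum a p r * shuffleSum b q s) v) u := by
  induction u, v using shuffle_induction generalizing a with
  | left v => simp only [shuffleSum_nil_left, splitSum_nil, tmul_eq_splitSum]
  | right u => simp only [shuffleSum_nil_right, splitSum_nil, tmul_eq_splitSum]
  | step i u j v hu hv =>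
    simp only [shuffleSum_cons_cons, tmul_cons, shuffleSum_add, shuffleSum_mul_left, hu, hv,
      splitSum_cons, splitSum_add, shuffleSum_nil_left, shuffleSum_nil_right, add_mul]
    ring

/-- Group-like series: those whose coordinates multiply by the shuffle product. -/
structure IsGroupLike (a : TensorSeries ι) : Prop where
  nil : a [] = 1
  shuffle : ∀ u v, shuffleSum a u v = a u * a v

lemma IsGroupLike.tmul {a b : TensorSeries ι} (ha : IsGroupLike a) (hb : IsGroupLike b) :
    IsGroupLike (tmul a b) where
  nil := by rw [tmul_eq_splitSum, splitSum_nil, ha.nil, hb.nil, mul_one]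
  shuffle u v := by
    simp only [shuffleSum_tmul, ha.shuffle, hb.shuffle, splitSum, SigMMD.tmul, Finset.sum_mul_sum]
    exact Finset.sum_congr rfl fun _ _ => Finset.sum_congr rfl fun _ _ => mul_mul_mul_comm _ _ _ _

lemma isGroupLike_tone : IsGroupLike (tone : TensorSeries ι) where
  nil := rfl
  shuffle
    | [], v => by rw [shuffleSum_nil_left, tone, one_mul]
    | i :: u, [] => by rw [shuffleSum_nil_right, tone, mul_one]
    | i :: u, j :: v => by rw [shuffleSum_cons_cons]; simp [shuffleSum, tone]

lemma texp_eq_of_perm (h : ι → ℝ) {u v : List ι} (huv : u.Perm v) : texp h u = texp h v := by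
  rw [texp, texp, (huv.map h).prod_eq, huv.length_eq]

lemma isGroupLike_texp (h : ι → ℝ) : IsGroupLike (texp h) where
  nil := by simp [texp]
  shuffle u v := by
    have huv : (shuffles u v).map (texp h) =
        List.replicate ((u.length + v.length).choose u.length) (texp h (u ++ v)) := by
      rw [← length_shuffles, ← List.map_const']
      exact List.map_congr_left fun w hw => texp_eq_of_perm h (perm_of_mem_shuffles hw)
    rw [shuffleSum, huv, List.sum_replicate, nsmul_eq_mul, Nat.cast_add_choose]
    simp only [texp, List.map_append, List.prod_append, List.length_append]
    field_simp

end Shuffle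

section ExpProd

variable {α κ : Type*}

/-- The product of the tensor exponentials of `h a` along a list of indices `a`. Unlike in
`sigSeries`, the list of indices is arbitrary, which allows for induction. -/
def expProd (h : α → κ → ℝ) (l : List α) : TensorSeries κ :=
  (l.map fun a => texp (h a)).foldr tmul tone

lemma expProd_nil (h : α → κ → ℝ) : expProd h [] = tone := rfl

lemma expProd_cons (h : α → κ → ℝ) (a : α) (l : List α) :
    expProd h (a :: l) = tmul (texp (h a)) (expProd h l) := rfl

lemma sigSeries_eq_expProd {ι : Type*} {N : ℕ} (t : Fin (N + 1) → ℝ) (x : Fin (N + 1) → L2 ι) :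
    sigSeries t x =
      expProd (fun i => augment (increment t i) (increment x i : L2 ι))
        (List.finRange (N + 1)) := by
  rw [sigSeries, List.ofFn_eq_map, expProd]

lemma isGroupLike_expProd (h : α → κ → ℝ) (l : List α) : IsGroupLike (expProd h l) := by
  induction l with
  | nil => exact isGroupLike_tone
  | cons a l ih => exact (isGroupLike_texp _).tmul ih

lemma isGroupLike_sigSeries {ι : Type*} {N : ℕ} (t : Fin (N + 1) → ℝ) (x : Fin (N + 1) → L2 ι) :
    IsGroupLike (sigSeries t x) :=
  sigSeries_eq_expProd t x ▸ isGroupLike_expProd _ _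

/-! ### The signature determines the path -/

lemma sum_pow_div_factorial (a b : ℝ) (n : ℕ) :
    ∑ k ∈ Finset.range (n + 1), a ^ k / (k ! : ℝ) * (b ^ (n - k) / ((n - k) ! : ℝ)) =
      (a + b) ^ n / (n ! : ℝ) := by
  rw [add_pow, Finset.sum_div]
  refine Finset.sum_congr rfl fun k hk => ?_
  rw [Nat.cast_choose ℝ (Nat.lt_succ_iff.1 (Finset.mem_range.1 hk))]
  field_simp

lemma factorial_mul_sum_pow_div_factorial_succ (a b : ℝ) (n : ℕ) :
    (n ! : ℝ) * ∑ k ∈ Finset.range (n + 1),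
        a ^ k / ((k + 1) ! : ℝ) * (b ^ (n - k) / ((n - k) ! : ℝ)) =
      ∫ u in (0 : ℝ)..1, (b + u * a) ^ n := by
  calc (n ! : ℝ) * ∑ k ∈ Finset.range (n + 1),
        a ^ k / ((k + 1) ! : ℝ) * (b ^ (n - k) / ((n - k) ! : ℝ))
      = ∑ k ∈ Finset.range (n + 1),
          ∫ u in (0 : ℝ)..1, u ^ k * (n ! * (a ^ k / k ! * (b ^ (n - k) / (n - k) !))) := by
        rw [Finset.mul_sum]
        refine Finset.sum_congr rfl fun k _ => ?_
        rw [intervalIntegral.integral_mul_const, integral_pow, Nat.factorial_succ]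
        push_cast
        field_simp
        simp
    _ = ∫ u in (0 : ℝ)..1, (b + u * a) ^ n := by
        rw [← intervalIntegral.integral_finsetSum fun k _ =>
          (by fun_prop : Continuous _).intervalIntegrable _ _]
        refine intervalIntegral.integral_congr fun u _ => ?_
        have := sum_pow_div_factorial (u * a) b n
        rw [eq_div_iff (by positivity)] at this
        rw [add_comm b, ← this, Finset.sum_mul]
        refine Finset.sum_congr rfl fun k _ => ?_
        rw [mul_pow]
        ring

lemma expProd_replicate (h : α → κ → ℝ) (l : List α) (i : κ) (n : ℕ) :
    expProd h l (List.replicate n i) = (l.map (h · i)).sum ^ n / (n ! : ℝ) := by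
  induction l generalizing n with
  | nil => cases n <;> simp [expProd_nil, tone, List.replicate_succ]
  | cons a l ih =>
    rw [expProd_cons, tmul_eq_splitSum, splitSum_replicate]
    simp only [ih, texp, List.map_replicate, List.prod_replicate, List.length_replicate,
      List.map_cons, List.sum_cons]
    exact sum_pow_div_factorial _ _ _

lemma factorial_mul_expProd_cons_replicate (h : α → κ → ℝ) (a : α) (l : List α) (i j : κ)
    (n : ℕ) :
    n ! * expProd h (a :: l) (j :: List.replicate n i) =
      n ! * expProd h l (j :: List.replicate n i) +
        h a j * ∫ u in (0 : ℝ)..1, ((l.map (h · i)).sum + u * h a i) ^ n := by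
  rw [expProd_cons, tmul_cons, (isGroupLike_texp _).nil, one_mul, tmul_eq_splitSum,
    splitSum_replicate, mul_add, ← factorial_mul_sum_pow_div_factorial_succ,
    mul_left_comm (h a j), Finset.mul_sum _ _ (h a j)]
  simp only [expProd_replicate, texp, List.map_cons, List.map_replicate, List.prod_cons,
    List.prod_replicate, List.length_cons, List.length_replicate, mul_assoc, mul_div_assoc]

open scoped Polynomial

/-- The linear functional on polynomials with value `n! a (j iⁿ)` at `Xⁿ`. On the product of
the exponentials of the increments of a path it is `P ↦ ∫ P(T - s) dx^j_s`, where the coordinate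
`i` serves as the time `s` and `T` is the terminal time. -/
def wordMoment (i j : κ) (a : TensorSeries κ) : ℝ[X] →ₗ[ℝ] ℝ :=
  Polynomial.lsum fun n => (n ! * a (j :: List.replicate n i)) • LinearMap.id

lemma wordMoment_X_pow (i j : κ) (a : TensorSeries κ) (n : ℕ) :
    wordMoment i j a (Polynomial.X ^ n) = n ! * a (j :: List.replicate n i) := by
  simp [wordMoment, Polynomial.X_pow_eq_monomial]

lemma wordMoment_expProd_nil (h : α → κ → ℝ) (i j : κ) :
    wordMoment i j (expProd h []) = 0 := by
  ext n
  simp [wordMoment, expProd_nil, tone]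

lemma wordMoment_expProd_cons (h : α → κ → ℝ) (a : α) (l : List α) (i j : κ) (P : ℝ[X]) :
    wordMoment i j (expProd h (a :: l)) P = wordMoment i j (expProd h l) P +
      h a j * ∫ u in (0 : ℝ)..1, P.eval ((l.map (h · i)).sum + u * h a i) := by
  induction P using Polynomial.induction_on' with
  | add P Q hP hQ =>
    simp only [map_add, hP, hQ, Polynomial.eval_add]
    rw [intervalIntegral.integral_add ((by fun_prop : Continuous _).intervalIntegrable _ _)
      ((by fun_prop : Continuous _).intervalIntegrable _ _)]
    ring
  | monomial n c =>
    rw [← mul_one c, ← smul_eq_mul, ← Polynomial.smul_monomial, ← Polynomial.X_pow_eq_monomial]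
    simp only [map_smul, wordMoment_X_pow, factorial_mul_expProd_cons_replicate, smul_eq_mul,
      Polynomial.eval_smul, Polynomial.eval_pow, Polynomial.eval_X,
      intervalIntegral.integral_const_mul]
    ring

open Polynomial in
/-- The product of `X - T` over all times `T` still to go along a list of durations `τ a`. As a
test polynomial `P`, its derivative has zero integral against the increments along the list and
positive integral over any earlier step. -/
def nodePoly (τ : α → ℝ) (l : List α) : ℝ[X] :=
  (l.tails.map fun s => X - C (s.map τ).sum).prod

lemma nodePoly_cons (τ : α → ℝ) (a : α) (l : List α) :
    nodePoly τ (a :: l) = (.X - .C ((a :: l).map τ).sum) * nodePoly τ l := by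
  rw [nodePoly, List.tails_cons, List.map_cons, List.prod_cons, nodePoly]

lemma nodePoly_eval_sum (τ : α → ℝ) (l : List α) : (nodePoly τ l).eval (l.map τ).sum = 0 := by
  cases l <;> simp [nodePoly, List.tails]

lemma nodePoly_eval_pos {τ : α → ℝ} {l : List α} (hl : ∀ a ∈ l, 0 < τ a) {s : ℝ}
    (hs : (l.map τ).sum < s) : 0 < (nodePoly τ l).eval s := by
  induction l with
  | nil => simpa [nodePoly] using hs
  | cons a l ih =>
    obtain ⟨ha, hl⟩ := List.forall_mem_cons.1 hl
    rw [nodePoly_cons, Polynomial.eval_mul, Polynomial.eval_sub, Polynomial.eval_X,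
      Polynomial.eval_C]
    rw [List.map_cons, List.sum_cons] at hs ⊢
    exact mul_pos (by linarith) (ih hl (by linarith))

lemma nodePoly_derivative_eval_pos {τ : α → ℝ} {l : List α} (hl : ∀ a ∈ l, 0 < τ a) {s : ℝ}
    (hs : (l.map τ).sum ≤ s) : 0 < (nodePoly τ l).derivative.eval s := by
  induction l with
  | nil => simp [nodePoly]
  | cons a l ih =>
    obtain ⟨ha, hl⟩ := List.forall_mem_cons.1 hl
    rw [nodePoly_cons]
    rw [List.map_cons, List.sum_cons] at hs ⊢
    have hpos := nodePoly_eval_pos hl (show (l.map τ).sum < s by linarith)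
    have hder := ih hl (by linarith)
    simp only [Polynomial.derivative_mul, Polynomial.derivative_sub, Polynomial.derivative_X,
      Polynomial.derivative_C, sub_zero, one_mul, Polynomial.eval_add, Polynomial.eval_mul,
      Polynomial.eval_sub, Polynomial.eval_X, Polynomial.eval_C]
    exact add_pos_of_pos_of_nonneg hpos (mul_nonneg (by linarith) hder.le)

lemma mul_integral_derivative_eval (P : ℝ[X]) (r τ : ℝ) :
    τ * ∫ u in (0 : ℝ)..1, P.derivative.eval (r + u * τ) = P.eval (r + τ) - P.eval r := by
  simpa using intervalIntegral.integral_unitInterval_deriv_eq_sub (f := fun s => P.eval s)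
    (f' := fun s => P.derivative.eval s) (z₀ := r) (z₁ := τ) (by fun_prop)
    fun _ _ => P.hasDerivAt _

lemma wordMoment_derivative_nodePoly_mul {h : α → κ → ℝ} {i : κ} (j : κ) {l : List α}
    (hl : ∀ a ∈ l, 0 < h a i) (Q : ℝ[X]) :
    wordMoment i j (expProd h l) (nodePoly (h · i) l * Q).derivative = 0 := by
  induction l generalizing Q with
  | nil => rw [wordMoment_expProd_nil, LinearMap.zero_apply]
  | cons a l ih =>
    obtain ⟨ha, hl⟩ := List.forall_mem_cons.1 hl
    have hint := mul_integral_derivative_eval (nodePoly (h · i) (a :: l) * Q)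
      (l.map (h · i)).sum (h a i)
    have hstart := nodePoly_eval_sum (h · i) (a :: l)
    rw [List.map_cons, List.sum_cons, add_comm] at hstart
    rw [Polynomial.eval_mul, hstart, nodePoly_cons] at hint
    simp only [Polynomial.eval_mul, nodePoly_eval_sum, mul_zero, zero_mul, sub_zero,
      mul_eq_zero, ha.ne', false_or] at hint
    rw [wordMoment_expProd_cons, nodePoly_cons, hint, mul_zero, add_zero, mul_comm (_ - _),
      mul_assoc, ih hl]

lemma eq_of_wordMoment_expProd_eq {h h' : α → κ → ℝ} {i : κ} (hi : ∀ a, h a i = h' a i) (j : κ)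
    {l : List α} (hnonneg : ∀ a ∈ l, 0 ≤ h a i) (hpos : ∀ a ∈ l.tail, 0 < h a i)
    (heq : wordMoment i j (expProd h l) = wordMoment i j (expProd h' l)) :
    ∀ a ∈ l, h a j = h' a j := by
  induction l with
  | nil => simp
  | cons a l ih =>
    obtain ⟨ha, hnonneg⟩ := List.forall_mem_cons.1 hnonneg
    rw [List.tail_cons] at hpos
    have hi' : (h' · i) = (h · i) := funext fun a => (hi a).symm
    have hmoment (P : ℝ[X]) : wordMoment i j (expProd h l) P +
          h a j * ∫ u in (0 : ℝ)..1, P.eval ((l.map (h · i)).sum + u * h a i) =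
        wordMoment i j (expProd h' l) P +
          h' a j * ∫ u in (0 : ℝ)..1, P.eval ((l.map (h · i)).sum + u * h a i) := by
      simpa only [wordMoment_expProd_cons, hi', ← hi a] using DFunLike.congr_fun heq P
    have hzero := wordMoment_derivative_nodePoly_mul j hpos 1
    have hzero' : wordMoment i j (expProd h' l) (nodePoly (h · i) l * 1).derivative = 0 := by
      rw [← hi']
      exact wordMoment_derivative_nodePoly_mul j (fun b hb => hi b ▸ hpos b hb) 1
    have hint : 0 < ∫ u in (0 : ℝ)..1,
        (nodePoly (h · i) l).derivative.eval ((l.map (h · i)).sum + u * h a i) := by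
      refine intervalIntegral.intervalIntegral_pos_of_pos_on
        ((by fun_prop : Continuous _).intervalIntegrable _ _) (fun u hu => ?_) one_pos
      exact nodePoly_derivative_eval_pos hpos (le_add_of_nonneg_right (mul_nonneg hu.1.le ha))
    have haj : h a j = h' a j := by
      have := hmoment (nodePoly (h · i) l * 1).derivative
      rw [hzero, hzero', zero_add, zero_add, mul_one] at this
      exact mul_right_cancel₀ hint.ne' this
    refine List.forall_mem_cons.2
      ⟨haj, ih hnonneg (fun b hb => hpos b (List.mem_of_mem_tail hb)) (LinearMap.ext fun P => ?_)⟩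
    simpa only [haj, add_left_inj] using hmoment P

end ExpProd

section Increment

variable {N : ℕ}

lemma increment_injective {E : Type*} [AddGroup E] :
    Function.Injective (increment : (Fin (N + 1) → E) → Fin (N + 1) → E) := by
  intro x y h
  ext i
  induction i using Fin.induction with
  | zero => exact congrFun h 0
  | succ i ih =>
    have hi : x i.succ - x i.castSucc = y i.succ - y i.castSucc := congrFun h i.succ
    rwa [ih, sub_left_inj] at hi

lemma increment_nonneg {t : Fin (N + 1) → ℝ} (ht0 : 0 ≤ t 0) (ht : Monotone t)
    (i : Fin (N + 1)) : 0 ≤ increment t i := by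
  cases i using Fin.cases with
  | zero => exact ht0
  | succ i => exact sub_nonneg.2 (ht i.castSucc_lt_succ.le)

lemma sigSeries_injective {ι : Type*} {t : Fin (N + 1) → ℝ} (ht0 : 0 ≤ t 0) (ht : StrictMono t) :
    Function.Injective (sigSeries (ι := ι) t) := by
  intro x y hxy
  rw [sigSeries_eq_expProd, sigSeries_eq_expProd] at hxy
  refine increment_injective (funext fun i => lp.ext (funext fun j => ?_))
  refine eq_of_wordMoment_expProd_eq (h := fun i => augment (increment t i) (increment x i : L2 ι))
    (h' := fun i => augment (increment t i) (increment y i : L2 ι)) (i := none) (fun _ => rfl)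
    (some j) (fun i _ => increment_nonneg ht0 ht.monotone i) (fun i hi => ?_) (by rw [hxy]) i
    (List.mem_finRange i)
  rw [List.finRange_succ, List.tail_cons, List.mem_map] at hi
  obtain ⟨i, -, rfl⟩ := hi
  exact sub_pos.2 (ht i.castSucc_lt_succ)

end Increment

/-! ### Feature maps -/

section Domination

variable {Z α κ : Type*}

lemma summable_sq (g : L2 κ) : Summable fun i => g i ^ 2 := by
  simpa using (lp.memℓp g).summable (by simp)

lemma norm_sq_eq_tsum (g : L2 κ) : ‖g‖ ^ 2 = ∑' i, g i ^ 2 := by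
  simpa using lp.norm_rpow_eq_tsum (p := 2) (by simp) g

lemma continuous_of_forall_abs_apply_le [TopologicalSpace Z] {f : Z → L2 κ}
    (hf : ∀ w, Continuous fun z => f z w) (g : L2 κ) (hg : ∀ z w, |f z w| ≤ g w) :
    Continuous f := by
  refine continuous_iff_continuousAt.2 fun z₀ => tendsto_iff_norm_sub_tendsto_zero.2 ?_
  have hsq : Tendsto (fun z => ‖f z - f z₀‖ ^ 2) (𝓝 z₀) (𝓝 0) := by
    simp only [norm_sq_eq_tsum, lp.coeFn_sub, Pi.sub_apply]
    rw [← tsum_zero (α := ℝ) (β := κ)]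
    refine tendsto_tsum_of_dominated_convergence ((summable_sq g).mul_left 4) (fun w => ?_)
      (Eventually.of_forall fun z w => ?_)
    · simpa using (((hf w).tendsto z₀).sub_const (f z₀ w)).pow 2
    · rw [Real.norm_eq_abs, abs_sq]
      have hz := abs_le.1 (hg z w)
      have hz₀ := abs_le.1 (hg z₀ w)
      nlinarith
  simpa using hsq.sqrt

lemma abs_texp_le {h g : κ → ℝ} (hg : ∀ i, |h i| ≤ g i) (w : List κ) :
    |texp h w| ≤ texp g w := by
  have hprod : |(w.map h).prod| ≤ (w.map g).prod := by
    induction w with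
    | nil => simp
    | cons i w ih =>
      simp only [List.map_cons, List.prod_cons, abs_mul]
      exact mul_le_mul (hg i) ih (abs_nonneg _) ((abs_nonneg _).trans (hg i))
  rw [texp, texp, abs_div, Nat.abs_cast]
  gcongr

lemma abs_tmul_le {a b A B : TensorSeries κ} (ha : ∀ w, |a w| ≤ A w) (hb : ∀ w, |b w| ≤ B w)
    (w : List κ) : |tmul a b w| ≤ tmul A B w := by
  refine (Finset.abs_sum_le_sum_abs _ _).trans (Finset.sum_le_sum fun k _ => ?_)
  rw [abs_mul]
  exact mul_le_mul (ha _) (hb _) (abs_nonneg _) ((abs_nonneg _).trans (ha _))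

lemma abs_expProd_le {h g : α → κ → ℝ} (hg : ∀ a i, |h a i| ≤ g a i) (l : List α) (w : List κ) :
    |expProd h l w| ≤ expProd g l w := by
  induction l generalizing w with
  | nil => cases w <;> simp [expProd_nil, tone]
  | cons a l ih => exact abs_tmul_le (abs_texp_le (hg a)) ih w

lemma continuous_texp (w : List κ) : Continuous fun h : κ → ℝ => texp h w :=
  (continuous_list_prod w fun i _ => continuous_apply i).div_const _

lemma continuous_expProd [TopologicalSpace Z] {h : Z → α → κ → ℝ} (hh : Continuous h)
    (l : List α) (w : List κ) : Continuous fun z => expProd (h z) l w := by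
  induction l generalizing w with
  | nil => exact continuous_const
  | cons a l ih =>
    simp only [expProd_cons, tmul]
    exact continuous_finsetSum _ fun k _ =>
      ((continuous_texp _).comp ((continuous_apply a).comp hh)).mul (ih _)

end Domination

section Signature

variable {Z ι : Type*} {N : ℕ}

lemma increment_succ_nsmul {E : Type*} [AddGroup E] (c : E) (i : Fin (N + 1)) :
    increment (fun i : Fin (N + 1) => ((i : ℕ) + 1) • c) i = c := by
  cases i using Fin.cases with
  | zero => simp [increment]
  | succ i =>
    simp only [increment, Fin.cases_succ, Fin.val_succ, Fin.val_castSucc]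
    rw [succ_nsmul' c (i + 1), add_sub_cancel_right]

lemma abs_increment_apply_le {x : Fin (N + 1) → L2 ι} {g : L2 ι} (hg : ∀ i j, |x i j| ≤ g j)
    (i : Fin (N + 1)) (j : ι) : |increment x i j| ≤ 2 * g j := by
  have hg0 : 0 ≤ g j := (abs_nonneg _).trans (hg 0 j)
  cases i using Fin.cases with
  | zero => exact (hg 0 j).trans (by linarith)
  | succ i =>
    exact (abs_sub (x i.succ j) (x i.castSucc j)).trans (by linarith [hg i.succ j, hg i.castSucc j])

lemma abs_sigSeries_le {t : Fin (N + 1) → ℝ} (ht0 : 0 ≤ t 0) (ht : Monotone t)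
    {x : Fin (N + 1) → L2 ι} {g : L2 ι} (hg : ∀ i j, |x i j| ≤ g j) (w : List (Option ι)) :
    |sigSeries t x w| ≤ sigSeries t (fun i => ((i : ℕ) + 1) • (2 : ℝ) • g) w := by
  rw [sigSeries_eq_expProd, sigSeries_eq_expProd]
  refine abs_expProd_le (fun i j => ?_) _ _
  cases j with
  | none => exact (abs_of_nonneg (increment_nonneg ht0 ht i)).le
  | some j =>
    rw [increment_succ_nsmul]
    exact abs_increment_apply_le hg i j

lemma continuous_sigSeries [TopologicalSpace Z] (t : Fin (N + 1) → ℝ)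
    {x : Z → Fin (N + 1) → L2 ι} (hx : ∀ i j, Continuous fun z => x z i j)
    (w : List (Option ι)) : Continuous fun z => sigSeries t (x z) w := by
  simp only [sigSeries_eq_expProd]
  refine continuous_expProd (continuous_pi fun i => continuous_pi fun j => ?_) _ _
  cases j with
  | none => exact continuous_const
  | some j =>
    cases i using Fin.cases with
    | zero => exact hx 0 j
    | succ i => exact (hx i.succ j).sub (hx i.castSucc j)

end Signature

section Feature

variable {C κ : Type*} [TopologicalSpace C] {F : C → L2 κ}

/-- Injective feature maps into `ℓ²` with continuous coordinates, dominated by an element of `ℓ²`.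
Unlike continuity and boundedness of `F`, domination is inherited by signatures coordinate by
coordinate. -/
structure IsDominatedFeature (F : C → L2 κ) : Prop where
  continuous_apply : ∀ w, Continuous fun x => F x w
  dominated : ∃ g : L2 κ, ∀ x w, |F x w| ≤ g w
  injective : Function.Injective F

/-- Dominated feature maps the span of whose coordinates is an algebra of functions. -/
structure IsAlgebraicFeature (F : C → L2 κ) : Prop extends IsDominatedFeature F where
  one : ∃ w, ∀ x, F x w = 1
  mul : ∀ u v, ∃ l : List κ, ∀ x, F x u * F x v = (l.map (F x)).sum

lemma IsDominatedFeature.continuous (hF : IsDominatedFeature F) : Continuous F :=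
  hF.dominated.elim fun g hg => continuous_of_forall_abs_apply_le hF.continuous_apply g hg

lemma IsDominatedFeature.isClosedEmbedding [CompactSpace C] (hF : IsDominatedFeature F) :
    IsClosedEmbedding F :=
  hF.continuous.isClosedEmbedding hF.injective

lemma IsDominatedFeature.isAlgebraicFeature_signature {N : ℕ} {t : Fin (N + 1) → ℝ}
    (hF : IsDominatedFeature F) (ht0 : 0 ≤ t 0) (ht : StrictMono t) :
    IsAlgebraicFeature fun z : Fin (N + 1) → C => signature t fun i => F (z i) where
  continuous_apply :=
    continuous_sigSeries t fun i w => (hF.continuous_apply w).comp (_root_.continuous_apply i)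
  dominated := by
    obtain ⟨g, hg⟩ := hF.dominated
    exact ⟨signature t fun i => ((i : ℕ) + 1) • (2 : ℝ) • g,
      fun z => abs_sigSeries_le ht0 ht.monotone fun i => hg (z i)⟩
  injective z z' h := funext fun i =>
    hF.injective (congrFun (sigSeries_injective ht0 ht (congrArg Subtype.val h)) i)
  one := ⟨[], fun _ => (isGroupLike_sigSeries t _).nil⟩
  mul u v := ⟨shuffles u v, fun _ => ((isGroupLike_sigSeries t _).shuffle u v).symm⟩

/-- The coordinates of a dominated feature map, as bounded continuous functions. -/
def IsDominatedFeature.coord (hF : IsDominatedFeature F) (w : κ) : BoundedContinuousFunction C ℝ :=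
  .ofNormedAddCommGroup (fun x => F x w) (hF.continuous_apply w) (hF.dominated.choose w)
    fun x => hF.dominated.choose_spec x w

lemma IsAlgebraicFeature.coord_mul_coord_mem_span (hF : IsAlgebraicFeature F) (u v : κ) :
    hF.coord u * hF.coord v ∈ Submodule.span ℝ (Set.range hF.coord) := by
  obtain ⟨l, hl⟩ := hF.mul u v
  have hsum : hF.coord u * hF.coord v = (l.map hF.coord).sum := by
    ext x
    refine (hl x).trans ?_
    rw [← BoundedContinuousFunction.evalCLM_apply ℝ x, map_list_sum, List.map_map]
    rfl
  rw [hsum]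
  refine list_sum_mem fun f hf => ?_
  obtain ⟨w, -, rfl⟩ := List.mem_map.1 hf
  exact Submodule.subset_span ⟨w, rfl⟩

lemma IsAlgebraicFeature.mul_mem_span (hF : IsAlgebraicFeature F)
    {f g : BoundedContinuousFunction C ℝ} (hf : f ∈ Submodule.span ℝ (Set.range hF.coord))
    (hg : g ∈ Submodule.span ℝ (Set.range hF.coord)) :
    f * g ∈ Submodule.span ℝ (Set.range hF.coord) := by
  have hfg := Submodule.mul_mem_mul hf hg
  rw [Submodule.span_mul_span] at hfg
  refine Submodule.span_le.2 ?_ hfg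
  rintro _ ⟨_, ⟨u, rfl⟩, _, ⟨v, rfl⟩, rfl⟩
  exact hF.coord_mul_coord_mem_span u v

/-- The algebra of bounded continuous functions spanned by the coordinates of an algebraic feature
map, to which the Stone–Weierstrass theorem applies. -/
def IsAlgebraicFeature.coordAlgebra (hF : IsAlgebraicFeature F) :
    StarSubalgebra ℝ (BoundedContinuousFunction C ℝ) where
  toSubalgebra := Submodule.toSubalgebra (Submodule.span ℝ (Set.range hF.coord))
    (by
      obtain ⟨w, hw⟩ := hF.one
      exact Submodule.subset_span ⟨w, BoundedContinuousFunction.ext hw⟩)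
    (fun _ _ => hF.mul_mem_span)
  star_mem' {f} hf := by rwa [show star f = f from BoundedContinuousFunction.ext fun _ => rfl]

lemma IsAlgebraicFeature.separatesPoints_coordAlgebra (hF : IsAlgebraicFeature F) :
    (hF.coordAlgebra.map
      (BoundedContinuousFunction.toContinuousMapStarₐ ℝ)).SeparatesPoints := by
  intro x y hxy
  obtain ⟨w, hw⟩ : ∃ w, F x w ≠ F y w := by
    by_contra! h
    exact hxy (hF.injective (lp.ext (funext h)))
  exact ⟨_, ⟨_, ⟨hF.coord w, Submodule.subset_span ⟨w, rfl⟩, rfl⟩, rfl⟩, hw⟩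

end Feature

section MeanEmbedding

variable {C κ : Type*} [TopologicalSpace C] [PolishSpace C] [MeasurableSpace C] [BorelSpace C]
  {F : C → L2 κ}

/-- The mean embedding `μ ↦ ∫ F dμ` of a feature map. -/
def meanEmbedding {C κ : Type*} [MeasurableSpace C] (F : C → L2 κ) (μ : ProbabilityMeasure C) :
    L2 κ :=
  ∫ x, F x ∂(μ : Measure C)

lemma IsDominatedFeature.integrable (hF : IsDominatedFeature F) (μ : Measure C)
    [IsFiniteMeasure μ] : Integrable F μ := by
  obtain ⟨g, hg⟩ := hF.dominated
  refine .of_bound hF.continuous.aestronglyMeasurable ‖g‖ (ae_of_all _ fun x => ?_)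
  exact lp.norm_mono two_ne_zero fun w => (hg x w).trans (le_abs_self _)

lemma IsDominatedFeature.meanEmbedding_apply (hF : IsDominatedFeature F)
    (μ : ProbabilityMeasure C) (w : κ) :
    meanEmbedding F μ w = ∫ x, F x w ∂(μ : Measure C) :=
  ((lp.evalCLM ℝ (fun _ : κ => ℝ) 2 w).integral_comp_comm (hF.integrable μ)).symm

lemma IsAlgebraicFeature.meanEmbedding_injective (hF : IsAlgebraicFeature F) :
    Function.Injective (meanEmbedding F) := by
  intro μ ν h
  refine Subtype.ext (ext_of_forall_mem_subalgebra_integral_eq_of_polish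
    (P := μ) (P' := ν) hF.separatesPoints_coordAlgebra fun f hf => ?_)
  refine Submodule.span_induction (p := fun f _ => ∫ x, f x ∂(μ : Measure C) =
    ∫ x, f x ∂(ν : Measure C)) ?_ (by simp) (fun f g _ _ hf hg => ?_) (fun r f _ hf => ?_) hf
  · rintro _ ⟨w, rfl⟩
    refine ((hF.meanEmbedding_apply μ w).symm.trans ?_).trans (hF.meanEmbedding_apply ν w)
    rw [h]
  · simp only [BoundedContinuousFunction.add_apply]
    rw [integral_add (f.integrable _) (g.integrable _),
      integral_add (f.integrable _) (g.integrable _), hf, hg]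
  · simp only [BoundedContinuousFunction.smul_apply, integral_smul, hf]

lemma IsAlgebraicFeature.isDominatedFeature_meanEmbedding (hF : IsAlgebraicFeature F) :
    IsDominatedFeature (meanEmbedding F) where
  continuous_apply w := by
    simp only [hF.meanEmbedding_apply]
    exact ProbabilityMeasure.continuous_integral_boundedContinuousFunction (hF.coord w)
  dominated := by
    obtain ⟨g, hg⟩ := hF.dominated
    refine ⟨g, fun μ w => ?_⟩
    rw [hF.meanEmbedding_apply]
    simpa using norm_integral_le_of_norm_le_const (μ := (μ : Measure C)) (f := fun x => F x w)
      (ae_of_all _ fun x => hg x w)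
  injective := hF.meanEmbedding_injective

end MeanEmbedding

/-! ### Spaces of probability measures -/

section ProbabilityMeasure

/-- The evaluation `σ`-algebra on probability measures is the Borel `σ`-algebra of the weak
topology, so that laws of measure-valued random variables are Borel measures. -/
instance instBorelSpaceProbabilityMeasure {E : Type*} [TopologicalSpace E]
    [TopologicalSpace.PseudoMetrizableSpace E] [SecondCountableTopology E] [MeasurableSpace E]
    [BorelSpace E] : BorelSpace (ProbabilityMeasure E) where
  measurable_eq := by
    refine le_antisymm (measurable_iff_comap_le.1 ?_) OpensMeasurableSpace.borel_le
    let _ : MeasurableSpace (ProbabilityMeasure E) := borel _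
    have : BorelSpace (ProbabilityMeasure E) := ⟨rfl⟩
    refine Measurable.measure_of_isPiSystem_of_isProbabilityMeasure (S := {s : Set E | IsClosed s})
      (BorelSpace.measurable_eq.trans borel_eq_generateFrom_isClosed) isPiSystem_isClosed
      (μ := ((↑) : ProbabilityMeasure E → Measure E)) fun s hs => ?_
    refine measurable_of_tendsto_metrizable (fun n => Continuous.measurable ?_)
      (tendsto_pi_nhds.2 fun μ : ProbabilityMeasure E =>
        HasOuterApproxClosed.tendsto_lintegral_apprSeq hs (μ : Measure E))
    exact continuous_iff_continuousAt.2 fun μ =>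
      ProbabilityMeasure.tendsto_iff_forall_lintegral_tendsto.1 tendsto_id (hs.apprSeq n)

lemma polishSpace_of_compactSpace (C : Type*) [TopologicalSpace C] [CompactSpace C]
    [TopologicalSpace.MetrizableSpace C] : PolishSpace C :=
  letI := TopologicalSpace.metrizableSpaceMetric C
  inferInstance

variable {C E : Type*} [MeasurableSpace C] [MeasurableSpace E] {e : C → E}

lemma mem_range_map_of_ae_mem_range (he : MeasurableEmbedding e) {μ : ProbabilityMeasure E}
    (h : ∀ᵐ x ∂(μ : Measure E), x ∈ Set.range e) :
    μ ∈ Set.range fun ν : ProbabilityMeasure C => ν.map he.measurable.aemeasurable := by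
  have hmap : ((μ : Measure E).comap e).map e = μ := by
    rw [he.map_comap, Measure.restrict_eq_self_of_ae_mem h]
  have hprob : IsProbabilityMeasure ((μ : Measure E).comap e) :=
    (Measure.isProbabilityMeasure_map_iff he.measurable.aemeasurable).1 (hmap.symm ▸ μ.2)
  exact ⟨⟨_, hprob⟩, Subtype.ext hmap⟩

lemma isClosedEmbedding_map [TopologicalSpace C] [CompactSpace C] [BorelSpace C]
    [TopologicalSpace E] [T2Space E] [HasOuterApproxClosed E] [BorelSpace E]
    (he : IsClosedEmbedding e) :
    IsClosedEmbedding fun ν : ProbabilityMeasure C =>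
      ν.map he.measurableEmbedding.measurable.aemeasurable := by
  have := he.isEmbedding.t2Space
  refine (ProbabilityMeasure.continuous_map he.continuous).isClosedEmbedding fun μ ν h => ?_
  have hmap : (μ : Measure C).map e = (ν : Measure C).map e := congrArg Subtype.val h
  have hcomap := congrArg (Measure.comap e) hmap
  rw [he.measurableEmbedding.comap_map, he.measurableEmbedding.comap_map] at hcomap
  exact Subtype.ext hcomap

end ProbabilityMeasure

/-! ### Metrization -/

section Metrization

variable {α Y V : Type*} [TopologicalSpace Y] {law : α → Y} {D : α → α → ℝ}

lemma metrizes_norm_sub [SeminormedAddCommGroup V] (v : α → V) :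
    Metrizes (fun a b => ‖v a - v b‖) (TopologicalSpace.induced v inferInstance) where
  self a := by simp
  symm a b := norm_sub_rev _ _
  triangle a b c := norm_sub_le_norm_sub_add_norm_sub _ _ _
  isOpen_iff s := by
    let _ : PseudoMetricSpace α := .induced v inferInstance
    simp only [Metric.isOpen_iff (α := α), Set.subset_def, Metric.mem_ball', ← dist_eq_norm]
    rfl

/-- The pseudometric space of a pseudometric that metrizes a given topology; that topology is its
topology by definition. -/
abbrev Metrizes.pseudoMetricSpace {τ : TopologicalSpace α} (hD : Metrizes D τ) :
    PseudoMetricSpace α :=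
  .ofDistTopology D hD.self hD.symm hD.triangle hD.isOpen_iff

lemma Metrizes.eq_zero_iff [T0Space Y] (hD : Metrizes D (.induced law inferInstance)) (a b : α) :
    D a b = 0 ↔ law a = law b := by
  let _ := hD.pseudoMetricSpace
  exact Metric.inseparable_iff.symm.trans
    ((IsInducing.induced law).inseparable_iff.symm.trans inseparable_iff_eq)

lemma Metrizes.tendsto_iff {ι : Type*} {l : Filter ι}
    (hD : Metrizes D (.induced law inferInstance)) (a : ι → α) (b : α) :
    Tendsto (fun n => law (a n)) l (𝓝 (law b)) ↔ Tendsto (fun n => D (a n) b) l (𝓝 0) := by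
  let _ := hD.pseudoMetricSpace
  exact (IsInducing.induced law).tendsto_nhds_iff.symm.trans tendsto_iff_dist_tendsto_zero

end Metrization

section LawMetrization

variable {α C E κ : Type*} [TopologicalSpace C] [PolishSpace C] [MeasurableSpace C] [BorelSpace C]
  [MeasurableSpace E] {e : C → E} {G : E → L2 κ}

lemma IsDominatedFeature.aestronglyMeasurable_of_ae_mem_range (hG : IsDominatedFeature (G ∘ e))
    (he : MeasurableEmbedding e) {μ : ProbabilityMeasure E}
    (hμ : ∀ᵐ x ∂(μ : Measure E), x ∈ Set.range e) :
    AEStronglyMeasurable G (μ : Measure E) := by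
  obtain ⟨ν, rfl⟩ := mem_range_map_of_ae_mem_range he hμ
  exact he.aestronglyMeasurable_map_iff.2 hG.continuous.aestronglyMeasurable

lemma IsAlgebraicFeature.metrizes_law [CompactSpace C] [TopologicalSpace E] [T2Space E]
    [HasOuterApproxClosed E] [BorelSpace E] (hG : IsAlgebraicFeature (G ∘ e))
    (he : IsClosedEmbedding e) {law : α → ProbabilityMeasure E}
    (hlaw : ∀ a, ∀ᵐ x ∂(law a : Measure E), x ∈ Set.range e) :
    Metrizes (fun a b => ‖meanEmbedding G (law a) - meanEmbedding G (law b)‖)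
      (TopologicalSpace.induced law inferInstance) := by
  choose p hp using fun a => mem_range_map_of_ae_mem_range he.measurableEmbedding (hlaw a)
  obtain rfl := funext hp
  have hmean (ν : ProbabilityMeasure C) :
      meanEmbedding G (ν.map he.measurableEmbedding.measurable.aemeasurable) =
        meanEmbedding (G ∘ e) ν :=
    he.measurableEmbedding.integral_map G
  have hembed := hG.isDominatedFeature_meanEmbedding.isClosedEmbedding
  have hinduced := congrArg (TopologicalSpace.induced p)
    ((isClosedEmbedding_map he).eq_induced.symm.trans hembed.eq_induced)
  rw [induced_compose, induced_compose] at hinduced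
  simp only [hmean]
  exact hinduced ▸ metrizes_norm_sub fun a => meanEmbedding (G ∘ e) (p a)

end LawMetrization

/-! ### Filtered processes -/

section Compact

variable {N d : ℕ} {t : Fin (N + 1) → ℝ} {C : Set (State d)}

lemma isDominatedFeature_toL2 (hC : Bornology.IsBounded C) :
    IsDominatedFeature fun x : C => toL2 (x : State d) where
  continuous_apply j := by
    change Continuous fun x : C => (x : State d) j
    fun_prop
  dominated := by
    obtain ⟨R, hR⟩ := hC.exists_norm_le
    exact ⟨toL2 (WithLp.toLp 2 fun _ => R), fun x j =>
      (PiLp.norm_apply_le (x : State d) j).trans (hR x x.2)⟩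
  injective x y h := Subtype.ext (PiLp.ext fun j => congrArg (fun v : L2 (Fin d) => v j) h)

/-- The inclusion of the paths with values in `C` into path space, along which laws are pulled back
to the space `Fin (N + 1) → C`, compact for compact `C`. -/
def pathInclusion (N : ℕ) (C : Set (State d)) : (Fin (N + 1) → C) → PathSpace N d :=
  Pi.map fun _ => Subtype.val

lemma isClosedEmbedding_pathInclusion (hC : IsClosed C) :
    IsClosedEmbedding (pathInclusion N C) :=
  .piMap fun _ => hC.isClosedEmbedding_subtypeVal

lemma measurable_pathInclusion : Measurable (pathInclusion N C) :=
  measurable_pi_lambda _ fun i => measurable_subtype_coe.comp (measurable_pi_apply i)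

lemma mem_range_pathInclusion {x : PathSpace N d} :
    x ∈ Set.range (pathInclusion N C) ↔ ∀ i, x i ∈ C := by
  simp [pathInclusion, Set.range_piMap]

/-- The inclusion of the paths of laws on `C`-valued paths into the paths of laws on path space,
by push-forward along `pathInclusion`. -/
def lawPathInclusion (N : ℕ) (C : Set (State d)) :
    (Fin (N + 1) → ProbabilityMeasure (Fin (N + 1) → C)) →
      Fin (N + 1) → ProbabilityMeasure (PathSpace N d) :=
  Pi.map fun _ ν => ν.map measurable_pathInclusion.aemeasurable

lemma isClosedEmbedding_lawPathInclusion (hC : IsCompact C) :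
    IsClosedEmbedding (lawPathInclusion N C) :=
  have := isCompact_iff_compactSpace.1 hC
  .piMap fun _ => isClosedEmbedding_map (isClosedEmbedding_pathInclusion hC.isClosed)

lemma mem_range_lawPathInclusion (hC : IsClosed C)
    {μ : Fin (N + 1) → ProbabilityMeasure (PathSpace N d)}
    (hμ : ∀ i, ∀ᵐ x ∂(μ i : Measure (PathSpace N d)), x ∈ Set.range (pathInclusion N C)) :
    μ ∈ Set.range (lawPathInclusion N C) := by
  rw [lawPathInclusion, Set.range_piMap]
  exact fun i _ => mem_range_map_of_ae_mem_range
    (isClosedEmbedding_pathInclusion hC).measurableEmbedding (hμ i)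

lemma isAlgebraicFeature_S1 (ht0 : 0 ≤ t 0) (ht : StrictMono t) (hC : Bornology.IsBounded C) :
    IsAlgebraicFeature (S1 t ∘ pathInclusion N C) :=
  (isDominatedFeature_toL2 hC).isAlgebraicFeature_signature ht0 ht

lemma S2_lawPathInclusion (hC : IsClosed C)
    (μ : Fin (N + 1) → ProbabilityMeasure (Fin (N + 1) → C)) :
    S2 t (lawPathInclusion N C μ) =
      signature t fun i => meanEmbedding (S1 t ∘ pathInclusion N C) (μ i) :=
  congrArg (signature t) <| funext fun _ =>
    (isClosedEmbedding_pathInclusion hC).measurableEmbedding.integral_map (S1 t)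

lemma isAlgebraicFeature_S2 (ht0 : 0 ≤ t 0) (ht : StrictMono t) (hC : IsCompact C) :
    IsAlgebraicFeature (S2 t ∘ lawPathInclusion N C) := by
  have := hC.isClosed.polishSpace
  rw [show S2 t ∘ lawPathInclusion N C = _ from funext (S2_lawPathInclusion hC.isClosed)]
  exact (isAlgebraicFeature_S1 ht0 ht
    hC.isBounded).isDominatedFeature_meanEmbedding.isAlgebraicFeature_signature ht0 ht

end Compact

namespace FilteredProcess

variable {N d : ℕ} {K C : Set (State d)}

lemma path_mem_range_pathInclusion (𝕏 : FilteredProcess.{u} N d K) (hKC : K ⊆ C) (ω : 𝕏.Ω) :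
    𝕏.path ω ∈ Set.range (pathInclusion N C) :=
  mem_range_pathInclusion.2 fun i => hKC (𝕏.mem i ω)

lemma ae_ae_prediction_of_forall_path_mem (𝕏 : FilteredProcess.{u} N d K) {A : Set (PathSpace N d)}
    (hA : MeasurableSet A) (hmem : ∀ ω, 𝕏.path ω ∈ A) (i : Fin (N + 1)) :
    ∀ᵐ ω ∂𝕏.P, ∀ᵐ x ∂(𝕏.prediction ω i : Measure (PathSpace N d)), x ∈ A := by
  have hprob := 𝕏.prediction_ae_eq i hA
  rw [Set.eq_univ_of_forall (s := 𝕏.path ⁻¹' A) hmem, Set.indicator_univ,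
    condExp_const (𝕏.filtration.le i)] at hprob
  filter_upwards [hprob] with ω hω
  exact (prob_compl_eq_zero_iff hA).2 ((ENNReal.toReal_eq_one_iff _).1 hω)

lemma ae_law0_mem_range (𝕏 : FilteredProcess.{u} N d K) (hC : IsClosed C) (hKC : K ⊆ C) :
    ∀ᵐ x ∂(𝕏.law0 : Measure (PathSpace N d)), x ∈ Set.range (pathInclusion N C) :=
  (ae_map_iff 𝕏.measurable_path.aemeasurable
    (isClosedEmbedding_pathInclusion hC).isClosed_range.measurableSet).2
    (ae_of_all _ (𝕏.path_mem_range_pathInclusion hKC))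

lemma ae_law1_mem_range (𝕏 : FilteredProcess.{u} N d K) (hC : IsCompact C) (hKC : K ⊆ C) :
    ∀ᵐ μ ∂(𝕏.law1 : Measure (Fin (N + 1) → ProbabilityMeasure (PathSpace N d))),
      μ ∈ Set.range (lawPathInclusion N C) := by
  refine (ae_map_iff 𝕏.measurable_prediction.aemeasurable
    (isClosedEmbedding_lawPathInclusion hC).isClosed_range.measurableSet).2 ?_
  have hae := ae_all_iff.2 <| 𝕏.ae_ae_prediction_of_forall_path_mem
    (isClosedEmbedding_pathInclusion (N := N) hC.isClosed).isClosed_range.measurableSet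
    (𝕏.path_mem_range_pathInclusion hKC)
  filter_upwards [hae] with ω hω using mem_range_lawPathInclusion hC.isClosed hω

end FilteredProcess

section Discrepancy

variable {N d : ℕ} {t : Fin (N + 1) → ℝ} {K : Set (State d)}

lemma metrizes_D1 (ht0 : 0 ≤ t 0) (ht : StrictMono t) (hK : Bornology.IsBounded K) :
    Metrizes (D1 t) (tau0.{u} N d K) := by
  have hC := hK.isCompact_closure
  have := isCompact_iff_compactSpace.1 hC
  have := hC.isClosed.polishSpace
  have he := isClosedEmbedding_pathInclusion (N := N) hC.isClosed
  have hS := isAlgebraicFeature_S1 ht0 ht hC.isBounded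
  have hlaw (𝕏 : FilteredProcess.{u} N d K) := 𝕏.ae_law0_mem_range hC.isClosed subset_closure
  have hmean (𝕏 : FilteredProcess.{u} N d K) :
      ∫ ω, S1 t (𝕏.path ω) ∂𝕏.P = meanEmbedding (S1 t) 𝕏.law0 :=
    (integral_map 𝕏.measurable_path.aemeasurable
      (hS.aestronglyMeasurable_of_ae_mem_range he.measurableEmbedding (hlaw 𝕏))).symm
  refine (funext₂ fun 𝕏 𝕐 => ?_ : _ = D1 t) ▸ hS.metrizes_law he hlaw
  rw [D1, hmean, hmean]

lemma metrizes_D2 (ht0 : 0 ≤ t 0) (ht : StrictMono t) (hK : Bornology.IsBounded K) :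
    Metrizes (D2 t) (tau1.{u} N d K) := by
  have hC := hK.isCompact_closure
  have := isCompact_iff_compactSpace.1 hC
  have := hC.isClosed.polishSpace
  have := polishSpace_of_compactSpace (ProbabilityMeasure (Fin (N + 1) → closure K))
  have he := isClosedEmbedding_lawPathInclusion (N := N) hC
  have hS := isAlgebraicFeature_S2 ht0 ht hC
  have hlaw (𝕏 : FilteredProcess.{u} N d K) := 𝕏.ae_law1_mem_range hC subset_closure
  have hmean (𝕏 : FilteredProcess.{u} N d K) :
      ∫ ω, S2 t (𝕏.prediction ω) ∂𝕏.P = meanEmbedding (S2 t) 𝕏.law1 :=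
    (integral_map 𝕏.measurable_prediction.aemeasurable
      (hS.aestronglyMeasurable_of_ae_mem_range he.measurableEmbedding (hlaw 𝕏))).symm
  refine (funext₂ fun 𝕏 𝕐 => ?_ : _ = D2 t) ▸ hS.metrizes_law he hlaw
  rw [D2, hmean, hmean]

end Discrepancy

end

end SigMMD

theorem theorem2_general {N d : ℕ} (t : Fin (N + 1) → ℝ) (ht0 : 0 ≤ t 0) (ht : StrictMono t)
    (K : Set (State d)) (hK : Bornology.IsBounded K) :
    (Metrizes (D1 t) (tau0.{u} N d K) ∧
      (∀ 𝕏 𝕐 : FilteredProcess.{u} N d K, D1 t 𝕏 𝕐 = 0 ↔ 𝕏.law0 = 𝕐.law0) ∧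
      ∀ (𝕏 : ℕ → FilteredProcess.{u} N d K) (𝕐 : FilteredProcess.{u} N d K),
        Tendsto (fun n => (𝕏 n).law0) atTop (𝓝 𝕐.law0) ↔
          Tendsto (fun n => D1 t (𝕏 n) 𝕐) atTop (𝓝 0)) ∧
    (Metrizes (D2 t) (tau1.{u} N d K) ∧
      (∀ 𝕏 𝕐 : FilteredProcess.{u} N d K, D2 t 𝕏 𝕐 = 0 ↔ 𝕏.law1 = 𝕐.law1) ∧
      ∀ (𝕏 : ℕ → FilteredProcess.{u} N d K) (𝕐 : FilteredProcess.{u} N d K),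
        Tendsto (fun n => (𝕏 n).law1) atTop (𝓝 𝕐.law1) ↔
          Tendsto (fun n => D2 t (𝕏 n) 𝕐) atTop (𝓝 0)) := by
  have hD1 := metrizes_D1.{u} ht0 ht hK
  have hD2 := metrizes_D2.{u} ht0 ht hK
  exact ⟨⟨hD1, hD1.eq_zero_iff, hD1.tendsto_iff⟩, hD2, hD2.eq_zero_iff, hD2.tendsto_iff⟩

theorem theorem2 {N d : ℕ} (t : Fin (N + 1) → ℝ) (ht0 : t 0 = 0) (ht : StrictMono t)
    (K : Set (State d)) (hK : IsCompact K) :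
    (Metrizes (D1 t) (tau0.{u} N d K) ∧
      (∀ 𝕏 𝕐 : FilteredProcess.{u} N d K, D1 t 𝕏 𝕐 = 0 ↔ 𝕏.law0 = 𝕐.law0) ∧
      ∀ (𝕏 : ℕ → FilteredProcess.{u} N d K) (𝕐 : FilteredProcess.{u} N d K),
        Tendsto (fun n => (𝕏 n).law0) atTop (𝓝 𝕐.law0) ↔
          Tendsto (fun n => D1 t (𝕏 n) 𝕐) atTop (𝓝 0)) ∧
    (Metrizes (D2 t) (tau1.{u} N d K) ∧
      (∀ 𝕏 𝕐 : FilteredProcess.{u} N d K, D2 t 𝕏 𝕐 = 0 ↔ 𝕏.law1 = 𝕐.law1) ∧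
      ∀ (𝕏 : ℕ → FilteredProcess.{u} N d K) (𝕐 : FilteredProcess.{u} N d K),
        Tendsto (fun n => (𝕏 n).law1) atTop (𝓝 𝕐.law1) ↔
          Tendsto (fun n => D2 t (𝕏 n) 𝕐) atTop (𝓝 0)) :=
  theorem2_general t ht0.ge ht K hK.isBounded
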